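/- Call a partition whose parts are pairwise distinct and differ pairwise by at least $2$ a Rogers–Ramanujan partition. A chain of such a partition $\pi$ is a maximal block $\lambda,\lambda+2,\dots,\lambda+2(\ell-1)$ of parts of $\pi$ in which consecutive parts differ by exactly $2$; $\ell\ge 1$ is its length and $\lambda$ its least part. All parts of a chain have the same parity, and $\pi$ decomposes uniquely into its chains. Give a chain $\chi$ of length $\ell$ and least part $\lambda$ the weight $$\omega(\chi)=\begin{cases}2,&\text{if }\lambda\text{ is even},\\ 2\ell,&\text{if }\lambda=1,\\ 4\ell,&\text{if }\lambda>1\text{ is odd},\end{cases}$$ and put $\omega(\pi)=\prod_{\chi}\omega(\chi)$, the product over all chains $\chi$ of $\pi$ (so the empty partition has weight $1$). Then for every integer $n\ge 0$, $$\sum_{\pi}\omega(\pi)=\sum_{\pi'}2^{\nu_d(\pi')},$$ where $\pi$ runs over the Rogers–Ramanujan partitions of $n$, $\pi'$ runs over the partitions of $n$ into odd parts, and $\nu_d(\pi')$ is the number of different parts of $\pi'$. -/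

import Mathlib

namespace WeightedRR

/-- A Rogers–Ramanujan partition: the parts are distinct and any two of them differ by at
least `2`. -/
def IsRogersRamanujan {n : ℕ} (p : n.Partition) : Prop :=
  p.parts.Nodup ∧ ∀ x ∈ p.parts, ∀ y ∈ p.parts, x < y → x + 2 ≤ y

instance {n : ℕ} (p : n.Partition) : Decidable (IsRogersRamanujan p) := by
  unfold IsRogersRamanujan; infer_instance

/-- The Rogers–Ramanujan partitions of `n`. -/
def rogersRamanujan (n : ℕ) : Finset n.Partition :=
  Finset.univ.filter fun p => IsRogersRamanujan p

/-- The least element `λ(c)` of a nonempty finite set `c` of natural numbers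
(and `0` for the empty set, which never occurs below). -/
def leastPart (c : Finset ℕ) : ℕ := c.min.untopD 0

/-- The progression `m, m + 2, …, m + 2 (l - 1)`. -/
def progression (m l : ℕ) : Finset ℕ := (Finset.range l).image fun i => m + 2 * i

/-- The blocks of a set `s` of parts: the nonempty subsets of `s` in which consecutive
elements differ by exactly `2`. -/
def blocks (s : Finset ℕ) : Finset (Finset ℕ) :=
  s.powerset.filter fun c => c.Nonempty ∧ c = progression (leastPart c) c.card

/-- The chains of a set `s` of parts: the blocks that are maximal under inclusion. -/
def chains (s : Finset ℕ) : Finset (Finset ℕ) :=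
  (blocks s).filter fun c => ∀ d ∈ blocks s, c ⊆ d → d = c

/-- The weight of a chain `c` of length `l = c.card`: it is `2` if the parts are even,
`2 l` if the least part is `1`, and `4 l` if the least part is odd and greater than `1`. -/
def chainWeight (c : Finset ℕ) : ℕ :=
  if Even (leastPart c) then 2
  else if leastPart c = 1 then 2 * c.card
  else 4 * c.card

/-- The weight of a Rogers–Ramanujan partition: the product of the weights of its chains. -/
def weight {n : ℕ} (p : n.Partition) : ℕ :=
  ∏ c ∈ chains p.parts.toFinset, chainWeight c

/-- The number of different parts of a partition. -/
def numDistinctParts {n : ℕ} (p : n.Partition) : ℕ := p.parts.toFinset.card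

end WeightedRR

/-! Both sides are compared as generating functions, with `q` nilpotent in a commutative ring
(finally `X` in `ℤ⟦X⟧ / (X ^ (n + 1))`), so every infinite product or sum is finite.

Removing the initial chain, of least part `m + 1` and possibly empty, from a spaced set with all
parts above `m` gives a recursion in `m` (`spacedSum_eq`). The functional `theta : X ^ n ↦ q ^ (n ^
2)` satisfies `theta (X ^ l * h(X)) = q ^ (l ^ 2) * theta (h(q ^ (2 * l) * X))`: placing `l` parts
first pushes each later part up by `2 * l`. Hence `theta` of the product of the series `F_k(q ^ k *
X)`, `k ≥ m`, with `F_k` counting chains of least part `k + 1` by length, obeys the same recursion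
(`theta_chainProd`).

The weights make each `F_k` rational: `(1 + X) / (1 - X)` for even least part, its square for odd
least part above `1`, and `(1 + X ^ 2) / (1 - X) ^ 2` for least part `1`. The full product is the
case `a = b = c = 1` of `keySum`. Shifting `a`, then `b` by symmetry, then `c` turns that sum into
`∏ (1 + q ^ (2k+1)) ^ 2 * ∏ (1 + q ^ (2k+2))`, which by Euler's identity is `∏ (1 + q ^ (2k+1)) / (1
- q ^ (2k+1))`, the series of the right-hand side. -/

namespace WeightedRR

open PowerSeries

/-! ### Products over a nilpotent base, the functional `theta`, and the product formula for
`keySum`. -/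

section NilpotentBase

variable {R : Type*} [CommRing R]

/-- The geometric series `1 / (1 - y X)`. -/
noncomputable def geom (y : R) : R⟦X⟧ := PowerSeries.mk fun n => y ^ n

theorem geom_mul_one_sub (y : R) : geom y * (1 - C y * X) = 1 := by
  ext n
  rw [mul_sub, mul_one, ← mul_assoc, mul_comm (geom y) (C y), mul_assoc]
  cases n with
  | zero => simp [geom]
  | succ n => simp [geom, coeff_succ_mul_X, pow_succ', coeff_one]

theorem rescale_C (r y : R) : rescale r (C y) = C y := by
  ext n
  by_cases hn : n = 0 <;> simp [coeff_C, hn]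

theorem rescale_geom (r y : R) : rescale r (geom y) = geom (y * r) := by
  ext n
  simp [geom, mul_pow, mul_comm]

theorem eq_mul_geom_of_mul_one_sub {f g : R⟦X⟧} {y : R} (h : f * (1 - C y * X) = g) :
    f = g * geom y := by
  rw [← h, mul_assoc, mul_comm _ (geom y), geom_mul_one_sub, mul_one]

/-- The finite product `∏ (1 + y Q ^ k X)` over `k < M`. -/
noncomputable def numProd (Q : R) (M : ℕ) (y : R) : R⟦X⟧ := ∏ k ∈ Finset.range M, (1 + C (y * Q ^ k) * X)

/-- The finite product `∏ 1 / (1 - y Q ^ k X)` over `k < M`. -/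
noncomputable def denProd (Q : R) (M : ℕ) (y : R) : R⟦X⟧ := ∏ k ∈ Finset.range M, geom (y * Q ^ k)

theorem numProd_zero (Q : R) (M : ℕ) : numProd Q M 0 = 1 := by
  simp [numProd]

theorem geom_zero : geom (0 : R) = 1 := by
  simpa using geom_mul_one_sub (0 : R)

theorem denProd_zero (Q : R) (M : ℕ) : denProd Q M 0 = 1 := by
  simp [denProd, geom_zero]

theorem rescale_numProd (r Q : R) (M : ℕ) (y : R) :
    rescale r (numProd Q M y) = numProd Q M (y * r) := by
  simp only [numProd, map_prod, map_add, map_mul, map_one, rescale_X, rescale_C]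
  refine Finset.prod_congr rfl fun k _ => ?_
  ring

theorem rescale_denProd (r Q : R) (M : ℕ) (y : R) :
    rescale r (denProd Q M y) = denProd Q M (y * r) := by
  simp only [denProd, map_prod, rescale_geom]
  refine Finset.prod_congr rfl fun k _ => ?_
  ring_nf

/-- The factor of index `M` is `1` because `Q ^ M = 0`, so the finite product behaves like the
infinite one. -/
theorem numProd_eq {Q : R} {M : ℕ} (hQ : Q ^ M = 0) (y : R) :
    numProd Q M y = (1 + C y * X) * numProd Q M (y * Q) := by
  have h := Finset.prod_range_succ (fun k => (1 + C (y * Q ^ k) * X : R⟦X⟧)) M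
  rw [Finset.prod_range_succ'] at h
  simp only [hQ, mul_zero, map_zero, zero_mul, add_zero, mul_one, pow_zero] at h
  rw [numProd, ← h, mul_comm, numProd]
  simp only [pow_succ', mul_assoc]

theorem denProd_mul_one_sub {Q : R} {M : ℕ} (hQ : Q ^ M = 0) (y : R) :
    denProd Q M y * (1 - C y * X) = denProd Q M (y * Q) := by
  have h := Finset.prod_range_succ (fun k => geom (y * Q ^ k)) M
  rw [Finset.prod_range_succ'] at h
  simp only [hQ, mul_zero, geom_zero, mul_one, pow_zero] at h
  rw [denProd, ← h, mul_assoc, geom_mul_one_sub, mul_one, denProd]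
  simp only [pow_succ', mul_assoc]

/-- The linear functional sending `X ^ n` to `q ^ (n ^ 2)`, truncated at `n < M`. -/
noncomputable def theta (q : R) (M : ℕ) : R⟦X⟧ →ₗ[R] R :=
  ∑ n ∈ Finset.range M, q ^ (n ^ 2) • coeff n

theorem theta_apply (q : R) (M : ℕ) (h : R⟦X⟧) :
    theta q M h = ∑ n ∈ Finset.range M, q ^ (n ^ 2) * coeff n h := by
  simp [theta]

theorem theta_C_mul (q : R) (M : ℕ) (r : R) (h : R⟦X⟧) :
    theta q M (C r * h) = r * theta q M h := by
  rw [← smul_eq_C_mul, map_smul, smul_eq_mul]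

/-- This is `(n + 1) ^ 2 = n ^ 2 + 2 * n + 1`; the boundary term of the truncation carries `q ^ (M ^
2) = 0`. -/
theorem theta_X_mul {q : R} {M : ℕ} (hq : q ^ M = 0) (h : R⟦X⟧) :
    theta q M (X * h) = q * theta q M (rescale (q ^ 2) h) := by
  have hM : q ^ (M ^ 2) = 0 := pow_eq_zero_of_le (Nat.le_self_pow two_ne_zero M) hq
  have h1 := Finset.sum_range_succ (fun n => q ^ (n ^ 2) * coeff n (X * h)) M
  rw [Finset.sum_range_succ', hM] at h1
  simp only [coeff_succ_X_mul, coeff_zero_X_mul, mul_zero, add_zero, zero_mul] at h1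
  rw [theta_apply, ← h1, theta_apply, Finset.mul_sum]
  refine Finset.sum_congr rfl fun n _ => ?_
  rw [coeff_rescale]
  ring

theorem theta_X_pow_mul {q : R} {M : ℕ} (hq : q ^ M = 0) (l : ℕ) (h : R⟦X⟧) :
    theta q M (X ^ l * h) = q ^ (l ^ 2) * theta q M (rescale (q ^ (2 * l)) h) := by
  induction l generalizing h with
  | zero => simp
  | succ l ih =>
    rw [pow_succ, mul_assoc, ih, map_mul, rescale_X, mul_assoc, theta_C_mul, theta_X_mul hq,
      rescale_rescale]
    ring_nf

theorem theta_one {q : R} {M : ℕ} (hM : M ≠ 0) : theta q M 1 = 1 := by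
  rw [theta_apply, Finset.sum_eq_single_of_mem 0 (by simpa [Nat.pos_iff_ne_zero] using hM)]
  · simp
  · intro n _ hn
    simp [coeff_one, hn]

/-- The three-parameter sum which evaluates to an infinite product. -/
noncomputable def keySum (q : R) (M : ℕ) (a b c : R) : R :=
  theta q M ((1 + C (a * b * c) * X ^ 2) * (numProd (q ^ 2) M (a * b * q) *
    numProd (q ^ 2) M (a * c * q ^ 2) * numProd (q ^ 2) M (b * c * q ^ 2) *
    denProd (q ^ 2) M a * denProd (q ^ 2) M b * denProd (q ^ 2) M (c * q)))

theorem keySum_comm (q : R) (M : ℕ) (a b c : R) : keySum q M a b c = keySum q M b a c := by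
  unfold keySum
  congr 1
  rw [mul_comm a b]
  ring

theorem sq_pow_eq_zero {q : R} {M : ℕ} (hq : q ^ M = 0) : (q ^ 2) ^ M = 0 := by
  rw [← pow_mul, mul_comm, pow_mul, hq, zero_pow two_ne_zero]

/-- The integrands of the two sides differ by `X * h(X) - q * h(q ^ 2 * X)` for a suitable `h`, and
`theta` kills such a difference by `theta_X_mul`. -/
theorem keySum_shift {q : R} {M : ℕ} (hq : q ^ M = 0) (a b c : R) :
    keySum q M a b c = (1 + a * q) * keySum q M (a * q ^ 2) b c := by
  have hQ := sq_pow_eq_zero hq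
  set K := numProd (q ^ 2) M (a * b * q) *
    numProd (q ^ 2) M (a * c * q ^ 2) * numProd (q ^ 2) M (b * c * q ^ 2) *
    denProd (q ^ 2) M a * denProd (q ^ 2) M b * denProd (q ^ 2) M (c * q) with hK
  -- With numerators shifted and denominators unshifted, `B` is a common factor: all the series
  -- involved are polynomial multiples of it.
  set B := numProd (q ^ 2) M (a * b * q * q ^ 2) *
    numProd (q ^ 2) M (a * c * q ^ 2 * q ^ 2) * numProd (q ^ 2) M (b * c * q ^ 2 * q ^ 2) *
    denProd (q ^ 2) M a * denProd (q ^ 2) M b * denProd (q ^ 2) M (c * q) with hB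
  have e1 : K = (1 + C (a * b * q) * X) * (1 + C (a * c * q ^ 2) * X) *
      (1 + C (b * c * q ^ 2) * X) * B := by
    rw [hK, hB, numProd_eq hQ (a * b * q), numProd_eq hQ (a * c * q ^ 2),
      numProd_eq hQ (b * c * q ^ 2)]
    ring
  have e2 : rescale (q ^ 2) K =
      (1 - C a * X) * (1 - C b * X) * (1 - C (c * q) * X) * B := by
    rw [hK, hB]
    simp only [map_mul, rescale_numProd, rescale_denProd, ← denProd_mul_one_sub hQ]
    ring
  have e3 : keySum q M (a * q ^ 2) b c = theta q M ((1 + C (a * q ^ 2 * b * c) * X ^ 2) *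
      ((1 - C a * X) * (1 + C (b * c * q ^ 2) * X) * B)) := by
    rw [keySum, hB, numProd_eq hQ (b * c * q ^ 2), ← denProd_mul_one_sub hQ,
      show a * q ^ 2 * b * q = a * b * q * q ^ 2 by ring,
      show a * q ^ 2 * c * q ^ 2 = a * c * q ^ 2 * q ^ 2 by ring]
    congr 1
    ring
  -- The telescoping series is `h = a * (1 + b * c * X) * K`; after dividing out `B`, what remains
  -- is a polynomial identity.
  have e4 := theta_X_mul hq (C a * (1 + C (b * c) * X) * K)
  have e5 : rescale (q ^ 2) (C a * (1 + C (b * c) * X) * K) =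
      C a * (1 + C (b * c * q ^ 2) * X) *
        ((1 - C a * X) * (1 - C b * X) * (1 - C (c * q) * X) * B) := by
    rw [map_mul, e2]
    simp only [map_mul, map_add, map_one, rescale_X, rescale_C]
    ring
  rw [e5, ← theta_C_mul] at e4
  rw [e3, ← theta_C_mul, keySum, ← hK, ← sub_eq_zero, ← map_sub]
  rw [← sub_eq_zero, ← map_sub] at e4
  rw [← e4]
  congr 1
  rw [e1]
  simp only [map_mul, map_add, map_one, map_pow]
  ring

theorem keySum_eq_prod_mul {q : R} {M : ℕ} (hq : q ^ M = 0) (b c : R) :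
    keySum q M 1 b c = (∏ k ∈ Finset.range M, (1 + q ^ (2 * k + 1))) * keySum q M 0 b c := by
  have h : ∀ n, keySum q M 1 b c =
      (∏ k ∈ Finset.range n, (1 + q ^ (2 * k + 1))) * keySum q M (q ^ (2 * n)) b c := by
    intro n
    induction n with
    | zero => simp
    | succ n ih =>
      rw [ih, keySum_shift hq, Finset.prod_range_succ]
      ring_nf
  rw [h M, pow_mul, sq_pow_eq_zero hq]

theorem keySum_zero_zero {q : R} {M : ℕ} (hq : q ^ M = 0) (hM : M ≠ 0) :
    keySum q M 0 0 1 = ∏ k ∈ Finset.range M, (1 + q ^ (2 * k + 2)) := by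
  have hQ := sq_pow_eq_zero hq
  have h0 : ∀ c, keySum q M 0 0 c = theta q M (denProd (q ^ 2) M (c * q)) := by
    intro c
    simp [keySum, numProd_zero, denProd_zero]
  have hs : ∀ c, keySum q M 0 0 c = (1 + c * q ^ 2) * keySum q M 0 0 (c * q ^ 2) := by
    intro c
    -- With `a = b = 0` only one denominator product survives, and its own functional equation gives
    -- the shift in `c`.
    have e := denProd_mul_one_sub hQ (c * q)
    have e' : denProd (q ^ 2) M (c * q) = denProd (q ^ 2) M (c * q * q ^ 2) +
        C (c * q) * (X * denProd (q ^ 2) M (c * q)) := by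
      rw [← e]; ring
    rw [h0, e', map_add, theta_C_mul, theta_X_mul hq, rescale_denProd, h0,
      show c * q ^ 2 * q = c * q * q ^ 2 by ring]
    ring
  have h : ∀ n, keySum q M 0 0 1 =
      (∏ k ∈ Finset.range n, (1 + q ^ (2 * k + 2))) * keySum q M 0 0 (q ^ (2 * n)) := by
    intro n
    induction n with
    | zero => simp
    | succ n ih =>
      rw [ih, hs, Finset.prod_range_succ]
      ring_nf
  rw [h M, pow_mul, hQ, h0, zero_mul, denProd_zero, theta_one hM, mul_one]

theorem keySum_one {q : R} {M : ℕ} (hq : q ^ M = 0) (hM : M ≠ 0) :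
    keySum q M 1 1 1 = (∏ k ∈ Finset.range M, (1 + q ^ (2 * k + 1))) ^ 2 *
      ∏ k ∈ Finset.range M, (1 + q ^ (2 * k + 2)) := by
  rw [keySum_eq_prod_mul hq, keySum_comm, keySum_eq_prod_mul hq, keySum_zero_zero hq hM]
  ring

/-- Euler's identity between odd and distinct parts, over a ring in which `q` is nilpotent. -/
theorem prod_one_add_mul_prod_one_sub {q : R} {M : ℕ} (hq : q ^ M = 0) :
    ((∏ k ∈ Finset.range M, (1 + q ^ (2 * k + 1))) *
      ∏ k ∈ Finset.range M, (1 + q ^ (2 * k + 2))) *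
      ∏ k ∈ Finset.range M, (1 - q ^ (2 * k + 1)) = 1 := by
  have hsplit : ∀ (f : ℕ → R) (n : ℕ), ∏ k ∈ Finset.range (2 * n), f (k + 1) =
      (∏ k ∈ Finset.range n, f (2 * k + 1)) * ∏ k ∈ Finset.range n, f (2 * k + 2) := by
    intro f n
    induction n with
    | zero => simp
    | succ n ih =>
      rw [show 2 * (n + 1) = 2 * n + 1 + 1 by ring, Finset.prod_range_succ,
        Finset.prod_range_succ, ih, Finset.prod_range_succ, Finset.prod_range_succ]
      ring
  -- Multiplying `(1 + q ^ j) * (1 - q ^ j) = 1 - q ^ (2 * j)` over `j ≤ 2 * M` leaves this product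
  -- on both sides; as a unit it cancels.
  have hu : IsUnit (∏ k ∈ Finset.range M, (1 - q ^ (2 * k + 2))) := by
    rw [IsUnit.prod_iff]
    intro k _
    have : IsNilpotent (q ^ (2 * k + 2)) := IsNilpotent.pow_of_pos ⟨M, hq⟩ (by omega)
    exact this.isUnit_one_sub
  have h1 := hsplit (fun k => 1 + q ^ k) M
  have h2 := hsplit (fun k => 1 - q ^ k) M
  have h3 : (∏ k ∈ Finset.range (2 * M), (1 + q ^ (k + 1))) *
      (∏ k ∈ Finset.range (2 * M), (1 - q ^ (k + 1))) =
      ∏ k ∈ Finset.range M, (1 - q ^ (2 * k + 2)) := by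
    rw [← Finset.prod_mul_distrib, two_mul, Finset.prod_range_add]
    conv_rhs => rw [← mul_one (∏ k ∈ Finset.range M, (1 - q ^ (2 * k + 2)))]
    congr 1
    · refine Finset.prod_congr rfl fun k _ => ?_
      ring
    · refine Finset.prod_eq_one fun k _ => ?_
      rw [pow_eq_zero_of_le (by omega : M ≤ M + k + 1) hq]
      ring
  apply hu.mul_right_cancel
  rw [h1, h2] at h3
  linear_combination h3

end NilpotentBase

/-! ### Generating series of single chains and their product under `theta`. -/

section ChainSeries

variable {R : Type*} [CommRing R]

/-- The weight of a chain with least part `m + 1` and length `l`, where an empty chain has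
weight `1`. -/
def lengthWeight (m l : ℕ) : ℕ :=
  if l = 0 then 1 else if Even (m + 1) then 2 else if m = 0 then 2 * l else 4 * l

theorem lengthWeight_add (m l j : ℕ) (hm : m ≠ 0) :
    lengthWeight (m + 2 * j) l = lengthWeight m l := by
  have h : Even (m + 2 * j + 1) ↔ Even (m + 1) := by grind
  have h' : m + 2 * j ≠ 0 := by omega
  simp only [lengthWeight, h, h', hm]

/-- The generating series of the chains with least part `m + 1` by their length. -/
noncomputable def chainSeries (R : Type*) [CommRing R] (m : ℕ) : R⟦X⟧ :=
  PowerSeries.mk fun l => (lengthWeight m l : R)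

theorem chainSeries_odd (k : ℕ) :
    chainSeries R (2 * k + 1) = (1 + X) * geom 1 := by
  apply eq_mul_geom_of_mul_one_sub
  rw [map_one, one_mul, mul_sub, mul_one]
  have he : Even (2 * k + 1 + 1) := by grind
  ext n
  rcases n with _ | _ | n <;>
  simp [chainSeries, lengthWeight, he, coeff_succ_mul_X, coeff_one, coeff_X]
  norm_num

theorem chainSeries_zero :
    chainSeries R 0 = (1 + X ^ 2) * geom 1 * geom 1 := by
  apply eq_mul_geom_of_mul_one_sub
  apply eq_mul_geom_of_mul_one_sub
  rw [map_one, one_mul, mul_sub, mul_one, mul_sub, sub_mul, mul_one]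
  ext n
  rcases n with _ | _ | _ | n <;>
  simp [chainSeries, lengthWeight, coeff_succ_mul_X, coeff_one, coeff_X_pow] <;> ring

theorem chainSeries_even (k : ℕ) :
    chainSeries R (2 * k + 2) = (1 + X) * (1 + X) * geom 1 * geom 1 := by
  apply eq_mul_geom_of_mul_one_sub
  apply eq_mul_geom_of_mul_one_sub
  have he : ¬ Even (2 * k + 2 + 1) := by grind
  rw [map_one, one_mul, mul_sub, mul_one, mul_sub, sub_mul, mul_one, mul_add, mul_one]
  ext n
  rcases n with _ | _ | _ | n <;>
  simp [chainSeries, lengthWeight, he, coeff_succ_mul_X, coeff_one, coeff_X] <;> ring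

/-- The product of the chain series with least parts in `(m, M]`, where each part is reduced
by the minimal possible parts below it. -/
noncomputable def chainProd (q : R) (M m : ℕ) : R⟦X⟧ :=
  ∏ k ∈ Finset.Ico m M, rescale (q ^ k) (chainSeries R k)

theorem rescale_chainSeries_eq_one {q : R} {M k : ℕ} (hq : q ^ M = 0) (hk : M ≤ k) :
    rescale (q ^ k) (chainSeries R k) = 1 := by
  rw [pow_eq_zero_of_le hk hq]
  ext n
  by_cases hn : n = 0 <;> simp [chainSeries, lengthWeight, coeff_one, hn]

theorem chainProd_eq {q : R} {M B : ℕ} (hq : q ^ M = 0) (m : ℕ) (hB : M ≤ B) :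
    chainProd q M m = ∏ k ∈ Finset.Ico m B, rescale (q ^ k) (chainSeries R k) := by
  refine Finset.prod_subset (Finset.Ico_subset_Ico_right hB) fun k hk hk' => ?_
  apply rescale_chainSeries_eq_one hq
  simp only [Finset.mem_Ico] at hk hk'
  omega

theorem chainProd_succ {q : R} {M : ℕ} (hq : q ^ M = 0) (m : ℕ) :
    chainProd q M m = rescale (q ^ m) (chainSeries R m) * chainProd q M (m + 1) := by
  rw [chainProd_eq (B := M + m + 1) hq m (by omega),
    chainProd_eq (B := M + m + 1) hq (m + 1) (by omega),
    Finset.prod_eq_prod_Ico_succ_bot (by omega)]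

/-- Moving a least part by `2 * l` keeps its parity, hence its weight. Starting at `m + 1` avoids
the exceptional factor of least part `1`. -/
theorem rescale_chainProd {q : R} {M : ℕ} (hq : q ^ M = 0) (m l : ℕ) :
    rescale (q ^ (2 * l)) (chainProd q M (m + 1)) = chainProd q M (m + 1 + 2 * l) := by
  rw [chainProd_eq (B := M + 2 * l) hq (m + 1 + 2 * l) (by omega), ← Finset.prod_Ico_add',
    chainProd, map_prod]
  refine Finset.prod_congr rfl fun k hk => ?_
  rw [rescale_rescale]
  have hk' : k ≠ 0 := by
    rw [Finset.mem_Ico] at hk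
    omega
  ext n
  simp only [coeff_rescale, chainSeries, coeff_mk, lengthWeight_add k n l hk']
  ring

/-- Expanding the first factor in powers of `X` gives the recursion that `spacedSum_eq` obtains by
removing a chain. -/
theorem theta_chainProd {q : R} {M : ℕ} (hq : q ^ M = 0) (m : ℕ) :
    theta q M (chainProd q M m) = ∑ l ∈ Finset.range M,
      (lengthWeight m l : R) * q ^ (m * l + l ^ 2) * theta q M (chainProd q M (m + 1 + 2 * l)) := by
  have hM : q ^ (M ^ 2) = 0 := pow_eq_zero_of_le (Nat.le_self_pow two_ne_zero M) hq
  rw [chainProd_succ hq, eq_X_pow_mul_shift_add_trunc M (rescale (q ^ m) (chainSeries R m)),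
    add_mul, map_add, mul_assoc, theta_X_pow_mul hq, hM, zero_mul, zero_add, trunc_apply,
    ← Finset.range_eq_Ico, ← Polynomial.coeToPowerSeries.ringHom_apply]
  simp only [map_sum, Finset.sum_mul, Polynomial.coeToPowerSeries.ringHom_apply,
    Polynomial.coe_monomial, monomial_eq_C_mul_X_pow, mul_assoc, theta_C_mul, theta_X_pow_mul hq, rescale_chainProd hq]
  refine Finset.sum_congr rfl fun l _ => ?_
  simp only [coeff_rescale, chainSeries, coeff_mk]
  ring

theorem chainProd_eq_one {q : R} {M m : ℕ} (h : M ≤ m) : chainProd q M m = 1 := by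
  rw [chainProd, Finset.Ico_eq_empty_of_le h, Finset.prod_empty]

theorem prod_range_two_mul (f : ℕ → R⟦X⟧) (n : ℕ) :
    ∏ k ∈ Finset.range (2 * n), f (k + 1) =
      ∏ k ∈ Finset.range n, (f (2 * k + 1) * f (2 * k + 2)) := by
  induction n with
  | zero => simp
  | succ n ih =>
    rw [show 2 * (n + 1) = 2 * n + 1 + 1 by ring, Finset.prod_range_succ,
      Finset.prod_range_succ, ih, Finset.prod_range_succ]
    ring

theorem theta_chainProd_zero {q : R} {M : ℕ} (hq : q ^ M = 0) :
    theta q M (chainProd q M 0) = keySum q M 1 1 1 := by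
  have hQ := sq_pow_eq_zero hq
  -- The double pole of the series for least part `1` supplies the first factor of both `denProd` at
  -- `1`; the larger odd least parts supply the rest.
  have hden : denProd (q ^ 2) M (1 : R) = geom 1 * denProd (q ^ 2) M (q ^ 2) := by
    rw [mul_comm]
    apply eq_mul_geom_of_mul_one_sub
    rw [denProd_mul_one_sub hQ, one_mul]
  rw [keySum, chainProd_eq (B := 1 + 2 * M) hq 0 (by omega),
    Finset.prod_eq_prod_Ico_succ_bot (by omega), Finset.prod_Ico_eq_prod_range]
  have hr : 1 + 2 * M - (0 + 1) = 2 * M := by omega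
  simp only [one_mul, mul_one, map_one, pow_zero, rescale_one, RingHom.id_apply]
  rw [hr, hden, chainSeries_zero]
  simp_rw [show ∀ k, 0 + 1 + k = k + 1 by intro k; omega]
  rw [prod_range_two_mul fun k => rescale (q ^ k) (chainSeries R k)]
  simp only [numProd, denProd, chainSeries_odd, chainSeries_even, map_mul, map_add, map_one,
    rescale_X, rescale_geom, one_mul, Finset.prod_mul_distrib]
  simp only [← pow_mul, ← pow_succ', ← pow_add,
    show ∀ k, 2 + 2 * k = 2 * k + 2 by intro k; omega]
  simp only [map_pow]
  congr 1
  ring_nf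

end ChainSeries

/-! ### Chains of a finite set and removal of the initial chain. -/

/-- A finite set of natural numbers no two elements of which differ by exactly `1`. -/
def IsSpaced (s : Finset ℕ) : Prop := ∀ x ∈ s, ∀ y ∈ s, x < y → x + 2 ≤ y

instance (s : Finset ℕ) : Decidable (IsSpaced s) := by
  unfold IsSpaced; infer_instance

theorem mem_progression {m l x : ℕ} : x ∈ progression m l ↔ ∃ i < l, m + 2 * i = x := by
  simp [progression]

theorem card_progression (m l : ℕ) : (progression m l).card = l := by
  rw [progression, Finset.card_image_of_injective _ fun i j h => by simpa using h,
    Finset.card_range]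

theorem leastPart_progression (m : ℕ) {l : ℕ} (hl : l ≠ 0) : leastPart (progression m l) = m := by
  have h : (progression m l).min = WithTop.some m := by
    apply le_antisymm
    · exact Finset.min_le (mem_progression.2 ⟨0, Nat.pos_of_ne_zero hl, rfl⟩)
    · refine Finset.le_min fun x hx => ?_
      obtain ⟨i, -, rfl⟩ := mem_progression.1 hx
      exact WithTop.coe_le_coe.2 (Nat.le_add_right _ _)
  rw [leastPart, h]
  rfl

theorem sum_progression (m l : ℕ) : ∑ x ∈ progression (m + 1) l, x = m * l + l ^ 2 := by
  rw [progression, Finset.sum_image fun i _ j _ h => by simpa using h]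
  induction l with
  | zero => simp
  | succ l ih => rw [Finset.sum_range_succ, ih]; ring

theorem progression_zero (m : ℕ) : progression m 0 = ∅ := by simp [progression]

theorem mem_blocks {s c : Finset ℕ} :
    c ∈ blocks s ↔ ∃ m l, l ≠ 0 ∧ c = progression m l ∧ c ⊆ s := by
  simp only [blocks, Finset.mem_filter, Finset.mem_powerset]
  constructor
  · rintro ⟨h, hne, hc⟩
    exact ⟨_, _, (Finset.card_pos.2 hne).ne', hc, h⟩
  · rintro ⟨m, l, hl, rfl, h⟩
    refine ⟨h, ?_, ?_⟩
    · rw [← Finset.card_pos, card_progression]; omega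
    · rw [card_progression, leastPart_progression m hl]

/-- The product of the weights of the chains of a set of parts. -/
def setWeight (s : Finset ℕ) : ℕ := ∏ c ∈ chains s, chainWeight c

theorem setWeight_empty : setWeight ∅ = 1 := by
  simp [setWeight, chains, blocks]

theorem chainWeight_progression (m : ℕ) {l : ℕ} (hl : l ≠ 0) :
    chainWeight (progression (m + 1) l) = lengthWeight m l := by
  simp [chainWeight, lengthWeight, leastPart_progression _ hl, card_progression, hl]

/-- A block that starts in the progression cannot jump to `t`: its next element is at most `a + 2 *
l`. -/
theorem block_of_union {a l m k : ℕ} {t : Finset ℕ} (ht : ∀ x ∈ t, a + 2 * l < x)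
    (h : progression m k ⊆ progression a l ∪ t) :
    progression m k ⊆ progression a l ∨ progression m k ⊆ t := by
  by_cases hm : m ∈ progression a l
  · left
    intro x hx
    obtain ⟨i, hi, rfl⟩ := mem_progression.1 hx
    clear hx
    induction i with
    | zero => simpa using hm
    | succ i ih =>
      obtain ⟨j, hj, hj'⟩ := mem_progression.1 (ih (by omega))
      rcases Finset.mem_union.1 (h (mem_progression.2 ⟨i + 1, hi, rfl⟩)) with h1 | h1
      · exact h1
      · have := ht _ h1
        omega
  · right
    intro x hx
    rcases Finset.mem_union.1 (h hx) with h1 | h1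
    · obtain ⟨i, hi, rfl⟩ := mem_progression.1 hx
      have h0 : m ∈ progression m k := mem_progression.2 ⟨0, by omega, by omega⟩
      have h2 := ht m ((Finset.mem_union.1 (h h0)).resolve_left hm)
      obtain ⟨j, hj, hj'⟩ := mem_progression.1 h1
      omega
    · exact h1

theorem chains_union {a l : ℕ} (hl : l ≠ 0) {t : Finset ℕ} (ht : ∀ x ∈ t, a + 2 * l < x) :
    chains (progression a l ∪ t) = insert (progression a l) (chains t) := by
  have hlt : ∀ x ∈ progression a l, x < a + 2 * l := by
    intro x hx
    obtain ⟨i, hi, rfl⟩ := mem_progression.1 hx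
    omega
  have hsub : ∀ c d, c ∈ blocks (progression a l ∪ t) → c ⊆ d → d ⊆ progression a l →
      ¬ c ⊆ t := by
    intro c d hc hcd hd hct
    obtain ⟨m, k, hk, rfl, -⟩ := mem_blocks.1 hc
    have h0 : m ∈ progression m k := mem_progression.2 ⟨0, by omega, by omega⟩
    have := ht _ (hct h0)
    have := hlt _ (hd (hcd h0))
    omega
  have hblock : ∀ c, c ∈ blocks (progression a l ∪ t) ↔
      c ∈ blocks (progression a l) ∨ c ∈ blocks t := by
    intro c
    simp only [mem_blocks]
    constructor
    · rintro ⟨m, k, hk, rfl, h⟩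
      rcases block_of_union ht h with h | h
      · exact Or.inl ⟨m, k, hk, rfl, h⟩
      · exact Or.inr ⟨m, k, hk, rfl, h⟩
    · rintro (⟨m, k, hk, rfl, h⟩ | ⟨m, k, hk, rfl, h⟩)
      · exact ⟨m, k, hk, rfl, h.trans Finset.subset_union_left⟩
      · exact ⟨m, k, hk, rfl, h.trans Finset.subset_union_right⟩
  have hself : progression a l ∈ blocks (progression a l) :=
    mem_blocks.2 ⟨a, l, hl, rfl, subset_rfl⟩
  have hs : ∀ {u c : Finset ℕ}, c ∈ blocks u → c ⊆ u := fun hc =>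
    Finset.mem_powerset.1 (Finset.mem_filter.1 hc).1
  ext c
  simp only [chains, Finset.mem_insert, Finset.mem_filter]
  constructor
  · rintro ⟨hc, hmax⟩
    rcases (hblock c).1 hc with h | h
    · exact Or.inl (hmax _ ((hblock _).2 (Or.inl hself)) (hs h)).symm
    · exact Or.inr ⟨h, fun d hd hcd => hmax d ((hblock d).2 (Or.inr hd)) hcd⟩
  · rintro (rfl | ⟨hc, hmax⟩)
    · have hc := (hblock (progression a l)).2 (Or.inl hself)
      refine ⟨hc, fun d hd hcd => ?_⟩
      rcases (hblock d).1 hd with h | h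
      · exact (hs h).antisymm hcd
      · exact absurd (hcd.trans (hs h)) (hsub _ _ hc subset_rfl subset_rfl)
    · refine ⟨(hblock c).2 (Or.inr hc), fun d hd hcd => ?_⟩
      rcases (hblock d).1 hd with h | h
      · exact absurd (hs hc) (hsub _ _ ((hblock c).2 (Or.inr hc)) hcd (hs h))
      · exact hmax d h hcd

theorem setWeight_union (m l : ℕ) {t : Finset ℕ} (ht : ∀ x ∈ t, m + 1 + 2 * l < x) :
    setWeight (progression (m + 1) l ∪ t) = lengthWeight m l * setWeight t := by
  rcases eq_or_ne l 0 with rfl | hl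
  · simp [progression_zero, lengthWeight]
  · rw [setWeight, chains_union hl ht, Finset.prod_insert, chainWeight_progression m hl, setWeight]
    intro h
    have h1 : progression (m + 1) l ⊆ t :=
      Finset.mem_powerset.1 (Finset.mem_filter.1 (Finset.mem_filter.1 h).1).1
    have := ht _ (h1 (mem_progression.2 ⟨0, by omega, rfl⟩))
    omega

/-- The spaced sets of parts in the interval `(m, N]`. -/
def spacedSets (m N : ℕ) : Finset (Finset ℕ) := (Finset.Ioc m N).powerset.filter IsSpaced

theorem mem_spacedSets {m N : ℕ} {s : Finset ℕ} :
    s ∈ spacedSets m N ↔ (∀ x ∈ s, m < x ∧ x ≤ N) ∧ IsSpaced s := by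
  simp [spacedSets, Finset.subset_iff]

theorem isSpaced_union {a l : ℕ} {t : Finset ℕ} (ht : ∀ x ∈ t, a + 2 * l < x)
    (hs : IsSpaced t) : IsSpaced (progression a l ∪ t) := by
  intro x hx y hy hxy
  rcases Finset.mem_union.1 hx with h | h <;> rcases Finset.mem_union.1 hy with h' | h'
  · obtain ⟨i, hi, rfl⟩ := mem_progression.1 h
    obtain ⟨j, hj, rfl⟩ := mem_progression.1 h'
    omega
  · obtain ⟨i, hi, rfl⟩ := mem_progression.1 h
    have := ht _ h'
    omega
  · obtain ⟨i, hi, rfl⟩ := mem_progression.1 h'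
    have := ht _ h
    omega
  · exact hs x h y h' hxy

theorem exists_add_two_mul_notMem (s : Finset ℕ) (a : ℕ) : ∃ l, a + 2 * l ∉ s := by
  by_contra! h
  have h1 := Finset.le_sup (f := id) (h (s.sup id + 1))
  simp only [id] at h1
  omega

/-- The length of the longest progression with difference `2` in `s` starting from `a`. -/
def initialLength (s : Finset ℕ) (a : ℕ) : ℕ := Nat.find (exists_add_two_mul_notMem s a)

theorem initialLength_notMem (s : Finset ℕ) (a : ℕ) : a + 2 * initialLength s a ∉ s :=
  Nat.find_spec (exists_add_two_mul_notMem s a)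

theorem progression_initialLength_subset (s : Finset ℕ) (a : ℕ) :
    progression a (initialLength s a) ⊆ s := by
  intro x hx
  obtain ⟨i, hi, rfl⟩ := mem_progression.1 hx
  exact not_not.1 (Nat.find_min (exists_add_two_mul_notMem s a) hi)

theorem initialLength_union {a l : ℕ} {t : Finset ℕ} (ht : ∀ x ∈ t, a + 2 * l < x) :
    initialLength (progression a l ∪ t) a = l := by
  rw [initialLength, Nat.find_eq_iff]
  constructor
  · rw [Finset.mem_union, mem_progression]
    rintro (⟨i, hi, h⟩ | h)
    · omega
    · exact (ht _ h).false
  · intro i hi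
    rw [not_not, Finset.mem_union]
    exact Or.inl (mem_progression.2 ⟨i, hi, rfl⟩)

/-- A smaller `x` at even distance from `a` would be in the progression or be the first missing
term; at odd distance it would be adjacent to a term of the progression. -/
theorem lt_of_mem_sdiff_initial {s : Finset ℕ} {a x : ℕ} (hs : IsSpaced s) (ha : ∀ y ∈ s, a ≤ y)
    (hx : x ∈ s \ progression a (initialLength s a)) : a + 2 * initialLength s a < x := by
  rw [Finset.mem_sdiff, mem_progression] at hx
  obtain ⟨hx, hn⟩ := hx
  by_contra! hle
  have h0 := ha x hx
  obtain ⟨i, hi | hi⟩ : ∃ i, x = a + 2 * i ∨ x = a + 2 * i + 1 := ⟨(x - a) / 2, by omega⟩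
  · rcases lt_or_ge i (initialLength s a) with h | h
    · exact hn ⟨i, h, hi.symm⟩
    · apply initialLength_notMem s a
      rwa [show a + 2 * initialLength s a = x by omega]
  · have h1 := progression_initialLength_subset s a
      (mem_progression.2 ⟨i, by omega, rfl⟩)
    have := hs _ h1 x hx (by omega)
    omega

/-! ### The recursion for weighted spaced sets and its solution by `theta`. -/

section Sum

variable {R : Type*} [CommRing R]

/-- The weighted generating function of the spaced sets of parts in `(m, N]`. -/
def spacedSum (q : R) (N m : ℕ) : R :=
  ∑ s ∈ spacedSets m N, (setWeight s : R) * q ^ (∑ x ∈ s, x)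

theorem spacedSum_eq_one (q : R) {N m : ℕ} (h : N ≤ m) : spacedSum q N m = 1 := by
  have : spacedSets m N = {∅} := by
    ext s
    rw [mem_spacedSets, Finset.mem_singleton]
    constructor
    · rintro ⟨h1, -⟩
      refine Finset.eq_empty_of_forall_notMem fun x hx => ?_
      have := h1 x hx
      omega
    · rintro rfl
      simp [IsSpaced]
  simp [spacedSum, this, setWeight_empty]

theorem spacedSum_eq {q : R} {N : ℕ} (hq : q ^ (N + 1) = 0) (m : ℕ) :
    spacedSum q N m = ∑ l ∈ Finset.range (N + 1),
      (lengthWeight m l : R) * q ^ (m * l + l ^ 2) * spacedSum q N (m + 1 + 2 * l) := by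
  simp only [spacedSum, Finset.mul_sum]
  rw [Finset.sum_sigma']
  set S := (Finset.range (N + 1)).sigma fun l => spacedSets (m + 1 + 2 * l) N with hS
  have hmem : ∀ p : Σ _ : ℕ, Finset ℕ, p ∈ S → ∀ x ∈ p.2, m + 1 + 2 * p.1 < x := by
    intro p hp x hx
    rw [hS, Finset.mem_sigma, mem_spacedSets] at hp
    exact (hp.2.1 x hx).1
  -- The last part of a nonempty chain is `m + 2 * l - 1`, so the filter keeps the chains that fit
  -- below `N`.
  rw [← Finset.sum_filter_of_ne (p := fun p : Σ _ : ℕ, Finset ℕ => m + 2 * p.1 ≤ N + 1 ∨ p.1 = 0)]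
  · symm
    refine Finset.sum_bij' (fun p _ => progression (m + 1) p.1 ∪ p.2)
      (fun s _ => ⟨initialLength s (m + 1), s \ progression (m + 1) (initialLength s (m + 1))⟩)
      ?_ ?_ ?_ ?_ ?_
    · intro p hp
      rw [Finset.mem_filter] at hp
      have hlt := hmem p hp.1
      have h2 := hp.1
      rw [hS, Finset.mem_sigma, mem_spacedSets] at h2
      rw [mem_spacedSets]
      refine ⟨fun x hx => ?_, isSpaced_union hlt h2.2.2⟩
      rcases Finset.mem_union.1 hx with h | h
      · obtain ⟨i, hi, rfl⟩ := mem_progression.1 h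
        have := hp.2
        omega
      · have := h2.2.1 x h
        omega
    · intro s hs
      rw [mem_spacedSets] at hs
      have hbound : m + 2 * initialLength s (m + 1) ≤ N + 1 ∨ initialLength s (m + 1) = 0 := by
        by_contra! h
        have := progression_initialLength_subset s (m + 1)
          (mem_progression.2 ⟨initialLength s (m + 1) - 1, by omega, rfl⟩)
        have := hs.1 _ this
        omega
      rw [Finset.mem_filter, hS, Finset.mem_sigma, mem_spacedSets, Finset.mem_range]
      refine ⟨⟨by dsimp only; omega, fun x hx => ⟨?_, ?_⟩, ?_⟩, hbound⟩
      · exact lt_of_mem_sdiff_initial hs.2 (fun y hy => (hs.1 y hy).1) hx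
      · exact (hs.1 x (Finset.mem_sdiff.1 hx).1).2
      · exact fun x hx y hy => hs.2 x (Finset.mem_sdiff.1 hx).1 y (Finset.mem_sdiff.1 hy).1
    · rintro ⟨l, t⟩ hp
      have ht := hmem _ (Finset.mem_filter.1 hp).1
      dsimp only at ht ⊢
      rw [initialLength_union ht, Finset.union_sdiff_cancel_left]
      rw [Finset.disjoint_left]
      intro x hx hx'
      obtain ⟨i, hi, rfl⟩ := mem_progression.1 hx
      have := ht _ hx'
      omega
    · intro s _
      exact Finset.union_sdiff_of_subset (progression_initialLength_subset s (m + 1))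
    · rintro ⟨l, t⟩ hp
      have ht := hmem _ (Finset.mem_filter.1 hp).1
      dsimp only at ht ⊢
      rw [setWeight_union m l ht, Finset.sum_union, sum_progression, pow_add]
      · push_cast
        ring
      · rw [Finset.disjoint_left]
        intro x hx hx'
        obtain ⟨i, hi, rfl⟩ := mem_progression.1 hx
        have := ht _ hx'
        omega
  · rintro ⟨l, t⟩ - hne
    dsimp only at hne ⊢
    by_contra! hlt
    apply hne
    -- A chain that overshoots `N` has sum above `N`, so its term vanishes.
    have h1 : N + 1 ≤ m * l + l ^ 2 := by
      obtain ⟨k, rfl⟩ := Nat.exists_eq_succ_of_ne_zero hlt.2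
      simp only [Nat.succ_eq_add_one] at *
      nlinarith [Nat.zero_le (m * k), Nat.zero_le (k ^ 2)]
    rw [pow_eq_zero_of_le h1 hq]
    ring

/-- The two recursions agree and only call larger indices, so downward induction from `m ≥ N + 1`,
where both sides are `1`, applies. -/
theorem spacedSum_eq_theta {q : R} {N : ℕ} (hq : q ^ (N + 1) = 0) (m : ℕ) :
    spacedSum q N m = theta q (N + 1) (chainProd q (N + 1) m) := by
  have h : ∀ d m, N + 1 ≤ m + d →
      spacedSum q N m = theta q (N + 1) (chainProd q (N + 1) m) := by
    intro d
    induction d with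
    | zero =>
      intro m hm
      rw [spacedSum_eq_one q (by omega), chainProd_eq_one (by omega), theta_one (by omega)]
    | succ d ih =>
      intro m hm
      rw [spacedSum_eq hq, theta_chainProd hq]
      refine Finset.sum_congr rfl fun l _ => ?_
      rw [ih _ (by omega)]
  exact h (N + 1) m (by omega)

end Sum

/-! ### The generating function of partitions into odd parts. -/

section OddParts

/-- The weight of the part `i` occurring `c` times in a partition into odd parts, each of which
is counted with weight `2`. -/
def oddWeight (i _c : ℕ) : ℤ := if Even i then 0 else 2

theorem coeff_genFun_oddWeight (n : ℕ) :
    coeff n (Nat.Partition.genFun oddWeight) =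
      ((∑ p ∈ Nat.Partition.odds n, 2 ^ numDistinctParts p : ℕ) : ℤ) := by
  rw [Nat.Partition.coeff_genFun, Nat.Partition.odds, Nat.Partition.restricted,
    Finset.sum_filter, Nat.cast_sum]
  refine Finset.sum_congr rfl fun p _ => ?_
  rw [Finsupp.prod, Multiset.toFinsupp_support]
  split_ifs with h
  · rw [numDistinctParts, Finset.prod_congr rfl (g := fun _ => (2 : ℤ))]
    · simp
    · intro i hi
      rw [oddWeight, if_neg (h i (Multiset.mem_toFinset.1 hi))]
  · push Not at h
    obtain ⟨i, hi, he⟩ := h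
    rw [Finset.prod_eq_zero (Multiset.mem_toFinset.2 hi)]
    · simp
    · rw [oddWeight, if_pos he]

open scoped PowerSeries.WithPiTopology in
theorem genFun_factor_even (k : ℕ) :
    (1 + ∑' j, C (oddWeight (2 * k + 1 + 1) (j + 1)) * (X : ℤ⟦X⟧) ^ ((2 * k + 1 + 1) * (j + 1))) = 1 := by
  have h : Even (2 * k + 1 + 1) := by grind
  simp [oddWeight, h]

open scoped PowerSeries.WithPiTopology in
-- With `i = 2 * k + 1`, the factor is `1 + 2 * X ^ i + 2 * X ^ (2 * i) + ⋯`, a geometric series.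
theorem genFun_factor_odd (k : ℕ) :
    (1 + ∑' j, C (oddWeight (2 * k + 1) (j + 1)) * (X : ℤ⟦X⟧) ^ ((2 * k + 1) * (j + 1))) *
      (1 - X ^ (2 * k + 1)) = 1 + X ^ (2 * k + 1) := by
  have h : ¬ Even (2 * k + 1) := by grind
  have hs := Nat.Partition.summable_genFun_term oddWeight (2 * k)
  simp only [smul_eq_C_mul] at hs
  have h1 := hs.tsum_eq_zero_add
  have h2 : ∀ j, C (oddWeight (2 * k + 1) (j + 1 + 1)) * (X : ℤ⟦X⟧) ^ ((2 * k + 1) * (j + 1 + 1)) =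
      X ^ (2 * k + 1) * (C (oddWeight (2 * k + 1) (j + 1)) * X ^ ((2 * k + 1) * (j + 1))) := by
    intro j
    simp only [oddWeight, h, if_false]
    ring
  simp_rw [h2] at h1
  rw [hs.tsum_mul_left] at h1
  have h3 : C (oddWeight (2 * k + 1) (0 + 1)) * (X : ℤ⟦X⟧) ^ ((2 * k + 1) * (0 + 1)) =
      2 * X ^ (2 * k + 1) := by
    simp [oddWeight, h]
  rw [h3] at h1
  linear_combination h1

theorem map_eq_sum_coeff {R : Type*} [CommRing R] (f : ℤ⟦X⟧ →+* R) {M : ℕ} (hf : f X ^ M = 0)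
    (g : ℤ⟦X⟧) : f g = ∑ n ∈ Finset.range M, ((coeff n g : ℤ) : R) * f X ^ n := by
  conv_lhs => rw [eq_X_pow_mul_shift_add_trunc M g]
  rw [map_add, map_mul, map_pow, hf, zero_mul, zero_add, trunc_apply, ← Finset.range_eq_Ico,
    ← Polynomial.coeToPowerSeries.ringHom_apply]
  simp only [map_sum, Polynomial.coeToPowerSeries.ringHom_apply, Polynomial.coe_monomial,
    monomial_eq_C_mul_X_pow, map_mul, map_pow]
  refine Finset.sum_congr rfl fun n _ => ?_
  congr 1
  exact map_intCast (f.comp C) _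

open scoped PowerSeries.WithPiTopology in
theorem map_genFun_oddWeight {R : Type*} [CommRing R] (f : ℤ⟦X⟧ →+* R) {M : ℕ}
    (hf : f X ^ M = 0) :
    f (Nat.Partition.genFun oddWeight) * ∏ k ∈ Finset.range M, (1 - f X ^ (2 * k + 1)) =
      ∏ k ∈ Finset.range M, (1 + f X ^ (2 * k + 1)) := by
  set u : ℕ → ℤ⟦X⟧ := fun i =>
    1 + ∑' j, C (oddWeight (i + 1) (j + 1)) * X ^ ((i + 1) * (j + 1)) with hu
  have hprod : HasProd u (Nat.Partition.genFun oddWeight) := by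
    have := Nat.Partition.hasProd_genFun oddWeight
    simpa only [smul_eq_C_mul] using this
  have hodd : ∀ k, f (u (2 * k)) * (1 - f X ^ (2 * k + 1)) = 1 + f X ^ (2 * k + 1) := by
    intro k
    have : f (u (2 * k) * (1 - X ^ (2 * k + 1))) = f (1 + X ^ (2 * k + 1)) :=
      congrArg f (genFun_factor_odd k)
    generalize u (2 * k) = v at this ⊢
    rwa [map_mul, map_sub, map_add, map_one, map_pow] at this
  have heven : ∀ k, f (u (2 * k + 1)) = 1 := by
    intro k
    rw [hu]
    simp only [genFun_factor_even, map_one]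
  have hlarge : ∀ i, 2 * M ≤ i → f (u i) = 1 := by
    intro i hi
    obtain ⟨k, rfl | rfl⟩ := Nat.even_or_odd' i
    · have h := hodd k
      rwa [pow_eq_zero_of_le (by omega) hf, sub_zero, add_zero, mul_one] at h
    · exact heven k
  have hfin : f (Nat.Partition.genFun oddWeight) = ∏ i ∈ Finset.range (2 * M), f (u i) := by
    -- No continuity of `f` is needed: `f` sees only coefficients below `M`, and over discrete `ℤ`
    -- these are eventually constant along the partial products.
    rw [HasProd, WithPiTopology.tendsto_iff_coeff_tendsto] at hprod
    have hev : ∀ n ∈ Finset.range M, ∀ᶠ s in Filter.atTop,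
        coeff n (∏ i ∈ s, u i) = coeff n (Nat.Partition.genFun oddWeight) := by
      intro n _
      have := hprod n
      rwa [nhds_discrete, Filter.tendsto_pure, SummationFilter.unconditional_filter] at this
    obtain ⟨s, hs1, hs2⟩ := (((Finset.eventually_all _).2 hev).and
      (Filter.eventually_ge_atTop (Finset.range (2 * M)))).exists
    rw [map_eq_sum_coeff f hf, Finset.sum_congr rfl fun n hn => by rw [← hs1 n hn],
      ← map_eq_sum_coeff f hf, map_prod]
    refine (Finset.prod_subset hs2 fun i _ hi => hlarge i ?_).symm
    simpa using hi
  have hsplit : ∀ n, ∏ i ∈ Finset.range (2 * n), f (u i) = ∏ k ∈ Finset.range n, f (u (2 * k)) := by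
    intro n
    induction n with
    | zero => simp
    | succ n ih =>
      rw [show 2 * (n + 1) = 2 * n + 1 + 1 by ring, Finset.prod_range_succ,
        Finset.prod_range_succ, ih, Finset.prod_range_succ, heven, mul_one]
  rw [hfin, hsplit, ← Finset.prod_mul_distrib]
  exact Finset.prod_congr rfl fun k _ => hodd k

end OddParts

/-! ### Comparison of the two generating functions. -/

/-- The generating function of the weighted Rogers–Ramanujan partitions. -/
noncomputable def rogersRamanujanSeries : ℤ⟦X⟧ :=
  PowerSeries.mk fun n => ((∑ p ∈ rogersRamanujan n, weight p : ℕ) : ℤ)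

theorem map_rogersRamanujanSeries {R : Type*} [CommRing R] (f : ℤ⟦X⟧ →+* R) {N : ℕ}
    (hf : f X ^ (N + 1) = 0) : f rogersRamanujanSeries = spacedSum (f X) N 0 := by
  rw [map_eq_sum_coeff f hf, spacedSum]
  have hcoeff : ∀ n ∈ Finset.range (N + 1), ((coeff n rogersRamanujanSeries : ℤ) : R) * f X ^ n =
      ∑ s ∈ spacedSets 0 N with ∑ x ∈ s, x = n, (setWeight s : R) * f X ^ (∑ x ∈ s, x) := by
    intro n hn
    rw [rogersRamanujanSeries, coeff_mk, Int.cast_natCast, Nat.cast_sum, Finset.sum_mul]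
    refine Finset.sum_bij (fun p _ => p.parts.toFinset) ?_ ?_ ?_ ?_
    · intro p hp
      obtain ⟨h1, h2⟩ := (Finset.mem_filter.1 hp).2
      rw [Finset.mem_filter, mem_spacedSets]
      refine ⟨⟨fun x hx => ?_, ?_⟩, ?_⟩
      · rw [Multiset.mem_toFinset] at hx
        refine ⟨p.parts_pos hx, (p.le_of_mem_parts hx).trans ?_⟩
        rw [Finset.mem_range] at hn
        omega
      · simpa [IsSpaced] using h2
      · rw [Finset.sum, Multiset.toFinset_val, h1.dedup, Multiset.map_id', p.parts_sum]
    · intro p hp p' hp' h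
      have h1 := (Finset.mem_filter.1 hp).2.1
      have h2 := (Finset.mem_filter.1 hp').2.1
      apply Nat.Partition.ext
      rw [← h1.dedup, ← h2.dedup]
      exact congrArg Finset.val h
    · intro s hs
      rw [Finset.mem_filter, mem_spacedSets] at hs
      obtain ⟨⟨h1, h2⟩, h3⟩ := hs
      refine ⟨⟨s.val, fun {i} hi => (h1 i hi).1, by simpa using h3⟩, ?_, by simp⟩
      rw [rogersRamanujan, Finset.mem_filter]
      exact ⟨Finset.mem_univ _, s.nodup, h2⟩
    · intro p hp
      obtain ⟨h1, h2⟩ := (Finset.mem_filter.1 hp).2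
      rw [Finset.sum, Multiset.toFinset_val, h1.dedup, Multiset.map_id', p.parts_sum]
      rfl
  rw [Finset.sum_congr rfl hcoeff]
  simp_rw [Finset.sum_filter]
  rw [Finset.sum_comm]
  refine Finset.sum_congr rfl fun s _ => ?_
  rw [Finset.sum_ite_eq]
  split_ifs with h
  · rfl
  · rw [Finset.mem_range, not_lt] at h
    rw [pow_eq_zero_of_le h hf, mul_zero]

/-- Modulo `X ^ (n + 1)` the variable is nilpotent, and the coefficient of `X ^ n` is still visible.
-/
theorem coeff_rogersRamanujanSeries_eq (n : ℕ) :
    coeff n rogersRamanujanSeries = coeff n (Nat.Partition.genFun oddWeight) := by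
  set f := Ideal.Quotient.mk (Ideal.span {(X : ℤ⟦X⟧) ^ (n + 1)}) with hf
  have hX : f X ^ (n + 1) = 0 := by
    rw [← map_pow, hf, Ideal.Quotient.eq_zero_iff_mem]
    exact Ideal.mem_span_singleton_self _
  have h1 : f rogersRamanujanSeries =
      (∏ k ∈ Finset.range (n + 1), (1 + f X ^ (2 * k + 1))) ^ 2 *
      ∏ k ∈ Finset.range (n + 1), (1 + f X ^ (2 * k + 2)) := by
    rw [map_rogersRamanujanSeries f hX, spacedSum_eq_theta hX, theta_chainProd_zero hX,
      keySum_one hX n.succ_ne_zero]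
  have h2 := map_genFun_oddWeight f hX
  have h3 := prod_one_add_mul_prod_one_sub hX
  have h4 : f rogersRamanujanSeries = f (Nat.Partition.genFun oddWeight) := by
    rw [h1]
    linear_combination f (Nat.Partition.genFun oddWeight) * h3 -
      (∏ k ∈ Finset.range (n + 1), (1 + f X ^ (2 * k + 1))) *
      (∏ k ∈ Finset.range (n + 1), (1 + f X ^ (2 * k + 2))) * h2
  rw [hf, Ideal.Quotient.eq, Ideal.mem_span_singleton, X_pow_dvd_iff] at h4
  have h5 := h4 n n.lt_succ_self
  rwa [map_sub, sub_eq_zero] at h5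

end WeightedRR

theorem theoremB (n : ℕ) :
    ∑ p ∈ WeightedRR.rogersRamanujan n, WeightedRR.weight p =
      ∑ p ∈ Nat.Partition.odds n, 2 ^ WeightedRR.numDistinctParts p := by
  have h := WeightedRR.coeff_rogersRamanujanSeries_eq n
  rw [WeightedRR.coeff_genFun_oddWeight, WeightedRR.rogersRamanujanSeries,
    PowerSeries.coeff_mk] at h
  exact_mod_cast h
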